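/- An overpartition of $n$ is a partition of $n$ in which the first occurrence of each part size may be overlined. For an overpartition $\lambda$ let $\lambda_1$ be its largest part ($0$ if $\lambda$ is empty), $\ell(\lambda)$ the number of its parts, and $\lambda_o$ the partition formed by its non-overlined odd parts. Let $\chi(\lambda)=1$ if the largest part of $\lambda$ is odd and (its first occurrence is) non-overlined, and $\chi(\lambda)=0$ otherwise. The $D$-rank of $\lambda$ is $\lambda_1-\ell(\lambda)$, and the $M_2$-rank of $\lambda$ is $\lceil \lambda_1/2\rceil-\ell(\lambda)+\ell(\lambda_o)-\chi(\lambda)$. For integers $m,n$ let $\overline{N}(m,n)$ and $\overline{N2}(m,n)$ denote the numbers of overpartitions of $n$ with $D$-rank $m$ and with $M_2$-rank $m$, respectively; both are $0$ for $n<0$. Theorem 1.4 (Chan–Mao monotonicity conjecture in the variable $n$). For all integers $m,n\ge 0$ with $n\ne m+2$ and $(m,n)\ne(0,4)$, $$\overline{N}(m,n)\ge \overline{N}(m,n-1).$$ For all integers $m,n\ge 0$, $$\overline{N2}(m,n)\ge \overline{N2}(m,n-1).$$ Moreover $\overline{N}(-m,n)=\overline{N}(m,n)$ and $\overline{N2}(-m,n)=\overline{N2}(m,n)$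 for all integers $m,n$, so that the inequalities hold for every integer $m$ (with the condition $n\ne|m|+2$ in the first one). -/

import Mathlib

/-- An overpartition of `n`: a partition of `n` in which the first occurrence of each part may be
overlined. It is given by the partition together with the set of those part sizes whose first
occurrence is overlined. -/
@[ext]
structure Overpartition (n : ℕ) where
  /-- the underlying partition of `n` -/
  toPartition : n.Partition
  /-- the sizes whose first occurrence is overlined -/
  overlined : Finset ℕ
  overlined_subset : overlined ⊆ toPartition.parts.toFinset

namespace Overpartition

/-- Overpartitions as pairs of a partition and a set of its part sizes. -/
def equivSigma (n : ℕ) :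
    Overpartition n ≃ Σ p : n.Partition, {s : Finset ℕ // s ∈ p.parts.toFinset.powerset} where
  toFun l := ⟨l.toPartition, l.overlined, Finset.mem_powerset.2 l.overlined_subset⟩
  invFun x := ⟨x.1, x.2.1, Finset.mem_powerset.1 x.2.2⟩
  left_inv _ := rfl
  right_inv _ := rfl

instance (n : ℕ) : Fintype (Overpartition n) := Fintype.ofEquiv _ (equivSigma n).symm

variable {n : ℕ}

/-- The multiset of all parts, overlined or not. -/
def parts (l : Overpartition n) : Multiset ℕ := l.toPartition.parts

/-- The largest part (`0` for the empty overpartition). -/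
def largest (l : Overpartition n) : ℕ := l.parts.sup

/-- The number of parts. -/
def length (l : Overpartition n) : ℕ := l.parts.card

/-- The multiset of the non-overlined parts: one copy of each overlined size is removed. -/
def nonOverlined (l : Overpartition n) : Multiset ℕ := l.parts - l.overlined.val

/-- The multiset of the non-overlined odd parts. -/
def nonOverlinedOdd (l : Overpartition n) : Multiset ℕ := l.nonOverlined.filter Odd

/-- The `D`-rank: the largest part minus the number of parts. -/
def dRank (l : Overpartition n) : ℤ := (l.largest : ℤ) - (l.length : ℤ)

/-- `1` if the largest part is odd and its first occurrence is not overlined, and `0` otherwise. -/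
def chi (l : Overpartition n) : ℤ :=
  if Odd l.largest ∧ l.largest ∉ l.overlined then 1 else 0

/-- The `M₂`-rank: half the largest part, rounded up, minus the number of parts, plus the number of
non-overlined odd parts, minus `chi`. -/
def m2Rank (l : Overpartition n) : ℤ :=
  ⌈(l.largest : ℚ) / 2⌉ - (l.length : ℤ) + (l.nonOverlinedOdd.card : ℤ) - l.chi

end Overpartition

/-- The number of overpartitions of the integer `n` with `D`-rank `m`; there are none if `n < 0`. -/
def overN (m : ℤ) : ℤ → ℕ
  | Int.ofNat n => Fintype.card {l : Overpartition n // l.dRank = m}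
  | Int.negSucc _ => 0

/-- The number of overpartitions of the integer `n` with `M₂`-rank `m`; there are none if
`n < 0`. -/
def overN2 (m : ℤ) : ℤ → ℕ
  | Int.ofNat n => Fintype.card {l : Overpartition n // l.m2Rank = m}
  | Int.negSucc _ => 0

/-! Write `z` for the rank variable, `w` for its inverse and `q` for the power series variable `X`.
Sorting overpartitions by largest part turns both rank generating functions into hypergeometric
series: `1 + 2q U₀` for the `D`-rank and `1 + 2q(1 + q) V₀` for the `M₂`-rank, with `U = dTail` and
`V = m2Tail` (`sum_T_dRank`, `sum_T_m2Rank`).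

A telescoping recursion (`hyperSum_recursion`) links each tail to the next. For the `D`-rank it
reads `(1 - w q^(i+1)) (1 - z q^(i+1)) U_i = 1 + q^(i+2) (1 + q^(i+1)) U_(i+1)`. Its coefficients
are invariant under `z ↔ w`, and iterating it determines the tails `q`-adically, so the tails are
invariant too; this is the symmetry of both ranks.

Monotonicity for the `M₂`-rank is an injection: adjoining a non-overlined part `1` preserves that
rank.

For the `D`-rank, put `J = 1 / ((1 - w q) (1 - z q))`. The recursion at `i = 0` gives `(1 - q) U₀ =
(1 - q) J + q² A U₁`, where `A = (1 - q²) J = ∑ z^m q^|m|`. Everything on the right is nonnegative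
except `-q J`, whose coefficients are `0` or `-1` and live only on `z^m q^(|m| + 2s + 1)`. Explicit
monomials of `A U₁` compensate each `-1`, apart from the excluded cases `n = m + 2` and `(m, n) =
(0, 4)`. -/

/-! ### Contribution of one part size to a partition generating function -/

open PowerSeries in
/-- The contribution `∑_{j ≥ 1} g j X^{i j}` of the part size `i` to a partition generating function,
where `g j` is the weight of `j` copies. -/
noncomputable def partSeries {R : Type*} [CommRing R] (i : ℕ) (g : ℕ → R) : PowerSeries R :=
  PowerSeries.mk fun n => if i ∣ n ∧ n ≠ 0 then g (n / i) else 0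

open PowerSeries in
theorem tsum_eq_partSeries {R : Type*} [CommRing R] [TopologicalSpace R] [DiscreteTopology R]
    (f : ℕ → ℕ → R) {i : ℕ} (hi : i ≠ 0) :
    (open scoped PowerSeries.WithPiTopology in
      ∑' j, f i (j + 1) • (X : PowerSeries R) ^ (i * (j + 1))) = partSeries i (f i) := by
  open scoped PowerSeries.WithPiTopology in
  ext n
  rw [(Nat.Partition.summable_genFun_term' f hi).map_tsum (coeff n)
    (WithPiTopology.continuous_coeff R n)]
  simp only [partSeries, coeff_mk, map_smul, coeff_X_pow, smul_eq_mul, mul_ite, mul_one, mul_zero]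
  by_cases h : i ∣ n ∧ n ≠ 0
  · obtain ⟨⟨k, rfl⟩, hk⟩ := h
    obtain ⟨j, rfl⟩ : ∃ j, k = j + 1 := Nat.exists_eq_succ_of_ne_zero (by rintro rfl; simp at hk)
    rw [tsum_eq_single j]
    · simp [hi, Nat.mul_div_cancel_left _ (Nat.pos_of_ne_zero hi)]
    · intro b hb
      rw [if_neg]
      simpa [hi] using fun h => hb h.symm
  · rw [if_neg h]
    convert tsum_zero with j
    rw [if_neg]
    rintro rfl
    exact h ⟨dvd_mul_right _ _, by simp [hi]⟩

/-- Bounding the part size makes Euler's product finite, so no topology is needed afterwards. -/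
theorem genFun_eq_prod {R : Type*} [CommRing R] (f : ℕ → ℕ → R) (N : ℕ)
    (hf : ∀ i, N < i → ∀ c, f i c = 0) :
    Nat.Partition.genFun f = ∏ i ∈ Finset.range N, (1 + partSeries (i + 1) (f (i + 1))) := by
  let _ : TopologicalSpace R := ⊥
  have _ : DiscreteTopology R := ⟨rfl⟩
  open scoped PowerSeries.WithPiTopology in
  rw [Nat.Partition.genFun_eq_tprod, tprod_eq_prod (s := Finset.range N)]
  · exact Finset.prod_congr rfl fun i _ => by rw [tsum_eq_partSeries f (Nat.succ_ne_zero i)]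
  · intro i hi
    simp only [Finset.mem_range, not_lt] at hi
    rw [tsum_eq_partSeries f (Nat.succ_ne_zero i)]
    ext n
    simp [partSeries, hf (i + 1) (by omega)]

open PowerSeries in
theorem partSeries_geometric {R : Type*} [CommRing R] {i : ℕ} (hi : i ≠ 0) (g : ℕ → R) (k a : R)
    (hg : ∀ c, c ≠ 0 → g c = k * a ^ c) :
    (1 - C a * X ^ i) * partSeries i g = C (k * a) * X ^ i := by
  have hi' : 0 < i := Nat.pos_of_ne_zero hi
  suffices h : partSeries i g = C (k * a) * X ^ i + C a * X ^ i * partSeries i g by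
    linear_combination h
  ext n
  rw [mul_assoc, map_add, coeff_C_mul, coeff_C_mul, coeff_X_pow, coeff_X_pow_mul']
  simp only [partSeries, coeff_mk]
  rcases lt_trichotomy n i with h | rfl | h
  · have h1 : ¬ (i ∣ n ∧ n ≠ 0) := fun ⟨h1, h2⟩ =>
      absurd (Nat.le_of_dvd (Nat.pos_of_ne_zero h2) h1) (by omega)
    rw [if_neg h1, if_neg (show ¬ n = i by omega), if_neg (show ¬ i ≤ n by omega)]
    simp
  · simp [hi, hg, Nat.div_self hi']
  · rw [if_neg (show ¬ n = i by omega), if_pos h.le]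
    by_cases h1 : i ∣ n
    · obtain ⟨j, rfl⟩ := h1
      obtain ⟨j, rfl⟩ : ∃ b, j = b + 2 := by
        refine ⟨j - 2, ?_⟩
        have : 1 < j := by
          by_contra hj
          have := Nat.mul_le_mul_left i (show j ≤ 1 by omega)
          omega
        omega
      have e : i * (j + 2) - i = i * (j + 1) := by
        rw [show i * (j + 2) = i * (j + 1) + i by ring]; omega
      rw [e]
      simp [hi, Nat.mul_div_cancel_left _ hi', hg]
      ring
    · have h2 : ¬ i ∣ n - i := fun h2 => h1 (by
        have := Nat.dvd_add h2 (dvd_refl i); rwa [Nat.sub_add_cancel h.le] at this)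
      rw [if_neg (fun h => h1 h.1), if_neg (fun h => h2 h.1)]
      simp

/-! ### Weighted counts of overpartitions by largest part -/

namespace Overpartition

/-- The multiplicative weight of an overpartition attached to a function `φ` of the part size, its
multiplicity and whether its first occurrence is overlined. -/
def weight {R : Type*} [CommRing R] (φ : ℕ → ℕ → Bool → R) {n : ℕ} (l : Overpartition n) : R :=
  ∏ i ∈ l.parts.toFinset, φ i (l.parts.count i) (decide (i ∈ l.overlined))

/-- For a fixed partition, summing over the sets of overlined sizes expands a product of binomials,
one for each part size. -/
theorem sum_weight {R : Type*} [CommRing R] (φ : ℕ → ℕ → Bool → R) (n : ℕ) :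
    ∑ l : Overpartition n, l.weight φ =
      PowerSeries.coeff n (Nat.Partition.genFun fun i c => φ i c true + φ i c false) := by
  rw [Nat.Partition.coeff_genFun, ← (equivSigma n).symm.sum_comp, Fintype.sum_sigma]
  refine Finset.sum_congr rfl fun p _ => ?_
  rw [Finsupp.prod, Multiset.toFinsupp_support, Finset.prod_add,
    ← Finset.sum_coe_sort (p.parts.toFinset.powerset)]
  refine Finset.sum_congr rfl fun s _ => ?_
  have hs := Finset.mem_powerset.1 s.2
  change ∏ i ∈ p.parts.toFinset, φ i (p.parts.count i) (decide (i ∈ s.1)) = _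
  rw [← Finset.prod_sdiff hs, mul_comm]
  congr 1
  · refine Finset.prod_congr rfl fun i hi => ?_
    simp [hi]
  · refine Finset.prod_congr rfl fun i hi => ?_
    simp [(Finset.mem_sdiff.1 hi).2]

theorem weight_restrict {R : Type*} [CommRing R] (φ : ℕ → ℕ → Bool → R) (N : ℕ) {n : ℕ}
    (l : Overpartition n) :
    l.weight (fun i c b => if i ≤ N then φ i c b else 0) =
      if l.largest ≤ N then l.weight φ else 0 := by
  unfold weight
  split_ifs with h
  · refine Finset.prod_congr rfl fun i hi => ?_
    exact if_pos ((Multiset.le_sup (Multiset.mem_toFinset.1 hi)).trans h)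
  · have : ∃ i ∈ l.parts, ¬ i ≤ N := by
      by_contra hc
      push Not at hc
      exact h (Multiset.sup_le.2 hc)
    obtain ⟨i, hi, hN⟩ := this
    exact Finset.prod_eq_zero (Multiset.mem_toFinset.2 hi) (if_neg hN)

/-- The weighted count of the overpartitions with largest part `N + 1`. -/
theorem sum_weight_largest {R : Type*} [CommRing R] (φ : ℕ → ℕ → Bool → R) (N n : ℕ) :
    ∑ l : Overpartition n, (if l.largest = N + 1 then l.weight φ else 0) =
      PowerSeries.coeff n
        ((∏ i ∈ Finset.range N,
          (1 + partSeries (i + 1) fun c => φ (i + 1) c true + φ (i + 1) c false)) *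
          partSeries (N + 1) fun c => φ (N + 1) c true + φ (N + 1) c false) := by
  have key : ∀ M : ℕ, ∑ l : Overpartition n, (if l.largest ≤ M then l.weight φ else 0) =
      PowerSeries.coeff n (∏ i ∈ Finset.range M,
          (1 + partSeries (i + 1) fun c => φ (i + 1) c true + φ (i + 1) c false)) := by
    intro M
    simp_rw [← weight_restrict]
    rw [sum_weight, genFun_eq_prod _ M (fun i hi c => by simp [not_le.2 hi])]
    congr 1
    refine Finset.prod_congr rfl fun i hi => ?_
    have : i + 1 ≤ M := Finset.mem_range.1 hi
    simp [this]
  -- "Largest part equal to `N + 1`" is the difference of two "at most" conditions, each of which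
  -- has a finite product.
  have split : ∀ l : Overpartition n, (if l.largest = N + 1 then l.weight φ else 0) =
      (if l.largest ≤ N + 1 then l.weight φ else 0) -
        (if l.largest ≤ N then l.weight φ else 0) := by
    intro l
    rcases lt_trichotomy l.largest (N + 1) with h | h | h
    · rw [if_neg (by omega), if_pos (by omega), if_pos (by omega), sub_self]
    · rw [if_pos h, if_pos (by omega), if_neg (by omega), sub_zero]
    · rw [if_neg (by omega), if_neg (by omega), if_neg (by omega), sub_zero]
  simp_rw [split, Finset.sum_sub_distrib, key, Finset.prod_range_succ, ← map_sub]
  congr 1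
  ring

theorem largest_le {n : ℕ} (l : Overpartition n) : l.largest ≤ n :=
  Multiset.sup_le.2 fun i hi => by
    have := Multiset.single_le_sum (fun _ _ => Nat.zero_le _) i hi
    rwa [parts, l.toPartition.parts_sum] at this

theorem largest_mem {n : ℕ} (l : Overpartition n) {N : ℕ} (h : l.largest = N + 1) :
    N + 1 ∈ l.parts := by
  by_contra hc
  have : l.largest ≤ N := Multiset.sup_le.2 fun i hi => by
    have h1 : i ≤ N + 1 := h ▸ Multiset.le_sup hi
    have h2 : i ≠ N + 1 := fun e => hc (e ▸ hi)
    omega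
  omega

theorem parts_eq_zero {n : ℕ} (l : Overpartition n) (h : l.largest = 0) : l.parts = 0 := by
  refine Multiset.eq_zero_of_forall_notMem fun i hi => ?_
  have h1 : i ≤ 0 := h ▸ Multiset.le_sup hi
  have h2 : 0 < i := l.toPartition.parts_pos hi
  omega

/-- The generating polynomial of a statistic on the overpartitions of `n` which, on those with
largest part `N + 1`, is `τ N` times a multiplicative weight. -/
theorem sum_eq_coeff {R : Type*} [CommRing R] (φ : ℕ → ℕ → ℕ → Bool → R) (τ : ℕ → R) {n : ℕ}
    (F : Overpartition n → R) (h0 : ∀ l, l.largest = 0 → F l = 1)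
    (hF : ∀ N l, l.largest = N + 1 → F l = τ N * l.weight (φ N)) {M : ℕ} (hM : n ≤ M) :
    ∑ l, F l = PowerSeries.coeff n (1 + ∑ N ∈ Finset.range M, PowerSeries.C (τ N) *
      ((∏ i ∈ Finset.range N,
          (1 + partSeries (i + 1) fun c => φ N (i + 1) c true + φ N (i + 1) c false)) *
          partSeries (N + 1) fun c => φ N (N + 1) c true + φ N (N + 1) c false)) := by
  have hsplit : ∀ l : Overpartition n, F l = (if l.largest = 0 then 1 else 0) +
      ∑ N ∈ Finset.range M, τ N * (if l.largest = N + 1 then l.weight (φ N) else 0) := by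
    intro l
    by_cases h : l.largest = 0
    · rw [h0 l h, if_pos h, Finset.sum_eq_zero, add_zero]
      intro N _
      rw [if_neg (by omega), mul_zero]
    · have := l.largest_le
      rw [if_neg h, zero_add, Finset.sum_eq_single (l.largest - 1)]
      · rw [if_pos (by omega), ← hF _ _ (by omega)]
      · intro N _ hN
        rw [if_neg (by omega), mul_zero]
      · intro hN
        exact absurd (Finset.mem_range.2 (by omega)) hN
  have hzero : ∑ l : Overpartition n, (if l.largest = 0 then (1 : R) else 0) =
      PowerSeries.coeff n (1 : PowerSeries R) := by
    have := sum_weight (fun i _ _ => if i ≤ 0 then (1 : R) else 0) n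
    have e := genFun_eq_prod (fun i (_ : ℕ) => (if i ≤ 0 then (1 : R) else 0) +
      if i ≤ 0 then (1 : R) else 0) 0 (fun i hi c => by simp [hi.ne'])
    rw [e, Finset.range_zero, Finset.prod_empty] at this
    rw [← this]
    refine Finset.sum_congr rfl fun l _ => ?_
    have h := weight_restrict (fun _ _ _ => (1 : R)) 0 l
    rw [h]
    simp [weight]
  simp_rw [hsplit, Finset.sum_add_distrib, hzero, map_add, map_sum, PowerSeries.coeff_C_mul]
  rw [Finset.sum_comm]
  simp_rw [← Finset.mul_sum, sum_weight_largest]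

end Overpartition

/-! ### Hypergeometric power series and their recursion -/

namespace PowerSeries

variable {R : Type*} [CommRing R]

theorem eq_of_forall_X_pow_dvd {f g : PowerSeries R} (h : ∀ n, X ^ n ∣ f - g) : f = g := by
  ext n
  have := X_pow_dvd_iff.1 (h (n + 1)) n n.lt_succ_self
  rwa [map_sub, sub_eq_zero] at this

/-- The sum of a sequence of power series whose `r`-th term is divisible by `X ^ r`. -/
noncomputable def limSum (a : ℕ → PowerSeries R) : PowerSeries R :=
  mk fun n => coeff n (∑ r ∈ Finset.range (n + 1), a r)

theorem coeff_limSum {a : ℕ → PowerSeries R} (ha : ∀ r, X ^ r ∣ a r) {n M : ℕ} (h : n < M) :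
    coeff n (limSum a) = coeff n (∑ r ∈ Finset.range M, a r) := by
  rw [limSum, coeff_mk, map_sum, map_sum]
  refine Finset.sum_subset (Finset.range_subset_range.2 h) fun r _ hr => ?_
  exact X_pow_dvd_iff.1 (ha r) n (by simpa using hr)

theorem X_pow_dvd_limSum_sub {a : ℕ → PowerSeries R} (ha : ∀ r, X ^ r ∣ a r) (M : ℕ) :
    X ^ M ∣ limSum a - ∑ r ∈ Finset.range M, a r := by
  rw [X_pow_dvd_iff]
  intro m hm
  rw [map_sub, coeff_limSum ha hm, sub_self]

/-- A linear relation between two sums whose termwise defect telescopes. -/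
theorem limSum_telescope {a b v : ℕ → PowerSeries R} {c d : PowerSeries R}
    (ha : ∀ r, X ^ r ∣ a r) (hb : ∀ r, X ^ r ∣ b r) (hv : ∀ r, X ^ r ∣ v r)
    (h : ∀ r, c * a r - d * b r = v r - v (r + 1)) :
    c * limSum a = v 0 + d * limSum b := by
  refine eq_of_forall_X_pow_dvd fun M => ?_
  have e : ∑ r ∈ Finset.range M, (c * a r - d * b r) = v 0 - v M := by
    simp_rw [h]; exact Finset.sum_range_sub' v M
  rw [Finset.sum_sub_distrib, ← Finset.mul_sum, ← Finset.mul_sum] at e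
  have : c * limSum a - (v 0 + d * limSum b) =
      c * (limSum a - ∑ r ∈ Finset.range M, a r) - d * (limSum b - ∑ r ∈ Finset.range M, b r) -
        v M := by linear_combination e
  rw [this]
  exact ((X_pow_dvd_limSum_sub ha M).mul_left c |>.sub
    ((X_pow_dvd_limSum_sub hb M).mul_left d)).sub (hv M)

/-- The inverse of `1 - u`, for `u` without constant coefficient. -/
noncomputable def oneSubInv (u : PowerSeries R) : PowerSeries R := invOfUnit (1 - u) 1

theorem one_sub_mul_oneSubInv {u : PowerSeries R} (hu : X ∣ u) : (1 - u) * oneSubInv u = 1 :=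
  mul_invOfUnit _ _ (by simp [X_dvd_iff.1 hu])

theorem isUnit_one_sub {u : PowerSeries R} (hu : X ∣ u) : IsUnit (1 - u) :=
  IsUnit.of_mul_eq_one _ (one_sub_mul_oneSubInv hu)

theorem eq_oneSubInv_mul {u f g : PowerSeries R} (hu : X ∣ u) (h : (1 - u) * f = g) :
    f = oneSubInv u * g := by
  rw [← h, ← mul_assoc, mul_comm (oneSubInv u), one_sub_mul_oneSubInv hu, one_mul]

theorem oneSubInv_eq {u : PowerSeries R} (hu : X ∣ u) : oneSubInv u = 1 + u * oneSubInv u := by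
  linear_combination one_sub_mul_oneSubInv hu

/-- The terms of a basic hypergeometric series of base `p` and argument `t`, with numerator
parameters `B`, `C`, `p` and denominator parameters `D`, `E`. -/
noncomputable def hyperTerm (p B C D E t : PowerSeries R) (r : ℕ) : PowerSeries R :=
  t ^ r * (∏ j ∈ Finset.range r, (1 - B * p ^ j) * (1 - C * p ^ j)) *
    ∏ j ∈ Finset.range (r + 1), oneSubInv (D * p ^ j) * oneSubInv (E * p ^ j)

/-- The sum of `hyperTerm`. -/
noncomputable def hyperSum (p B C D E t : PowerSeries R) : PowerSeries R :=
  limSum (hyperTerm p B C D E t)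

theorem X_pow_dvd_hyperTerm {p B C D E t : PowerSeries R} (ht : X ∣ t) (r : ℕ) :
    X ^ r ∣ hyperTerm p B C D E t r :=
  ((pow_dvd_pow_of_dvd ht r).mul_right _).mul_right _

/-- A three-term recursion, shifting `D` and `t`, for hypergeometric series whose argument is
`t = D E p / (B C)`. -/
theorem hyperSum_recursion {p B C D E t : PowerSeries R} (hD : X ∣ D) (hE : X ∣ E)
    (ht : X ∣ t) (h : t * B * C = D * E * p) :
    (1 - D) * (1 - t) * hyperSum p B C D E t =
      1 + (E + t * D * p - t * B - t * C) * hyperSum p B C (D * p) E (t * p) := by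
  -- Telescoping certificate: the `r`-th term of the shifted series, with `t ^ r` in place of `(t *
  -- p) ^ r` and without the last denominator factors.
  set v : ℕ → PowerSeries R := fun r =>
    t ^ r * (∏ j ∈ Finset.range r, (1 - B * p ^ j) * (1 - C * p ^ j)) *
      ∏ j ∈ Finset.range r, oneSubInv (D * p * p ^ j) * oneSubInv (E * p ^ j) with hv
  have h0 : v 0 = 1 := by simp [hv]
  refine (limSum_telescope (v := v) (X_pow_dvd_hyperTerm ht)
    (X_pow_dvd_hyperTerm (ht.mul_right p)) (fun r => ?_) fun r => ?_).trans (by rw [h0]; rfl)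
  · exact ((pow_dvd_pow_of_dvd ht r).mul_right _).mul_right _
  · have eD := one_sub_mul_oneSubInv hD
    have eDr := one_sub_mul_oneSubInv (u := D * p * p ^ r) ((hD.mul_right p).mul_right _)
    have eEr := one_sub_mul_oneSubInv (u := E * p ^ r) (hE.mul_right _)
    have hs : ∏ j ∈ Finset.range (r + 1), oneSubInv (D * p ^ j) =
        (∏ j ∈ Finset.range r, oneSubInv (D * p * p ^ j)) * oneSubInv D := by
      rw [Finset.prod_range_succ', pow_zero, mul_one]
      refine congrArg (· * _) (Finset.prod_congr rfl fun j _ => ?_)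
      rw [pow_succ', mul_assoc]
    simp only [hyperTerm, hv, Finset.prod_mul_distrib, mul_pow, hs]
    simp only [Finset.prod_range_succ]
    generalize ∏ j ∈ Finset.range r, oneSubInv (D * p * p ^ j) = P1
    generalize ∏ j ∈ Finset.range r, oneSubInv (E * p ^ j) = P2
    generalize ∏ j ∈ Finset.range r, (1 - B * p ^ j) = P3
    generalize ∏ j ∈ Finset.range r, (1 - C * p ^ j) = P4
    generalize oneSubInv (D * p * p ^ r) = x at *
    generalize oneSubInv (E * p ^ r) = y at *
    generalize oneSubInv D = d at *
    generalize p ^ r = Y at *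
    rw [pow_succ t r]
    generalize t ^ r = T at *
    linear_combination T * P3 * P4 * P1 * P2 * ((1 - t) * y * eD - (1 - t) * y * eDr +
      (1 - E * Y) * y * eDr + eEr + Y ^ 2 * x * y * h)

/-- A sequence determined by an `X`-adically contracting recursion with coefficients fixed by `σ`
is fixed by `σ`. -/
theorem fixed_of_recursion {σ : PowerSeries R →+* PowerSeries R} {U u g : ℕ → PowerSeries R}
    (hu : ∀ i, IsUnit (u i)) (hg : ∀ i, X ∣ g i) (σu : ∀ i, σ (u i) = u i)
    (σg : ∀ i, σ (g i) = g i) (h : ∀ i, u i * U i = 1 + g i * U (i + 1)) (i : ℕ) :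
    σ (U i) = U i := by
  refine eq_of_forall_X_pow_dvd fun n => ?_
  induction n generalizing i with
  | zero => simp
  | succ n ih =>
    have e := congrArg σ (h i)
    simp only [map_add, map_mul, map_one, σu, σg] at e
    -- The unit `u i` does not affect divisibility, the constants `1` cancel, and `g i` supplies one
    -- more factor `X`.
    rw [← (hu i).dvd_mul_left, mul_sub, e, h i, add_sub_add_left_eq_sub, ← mul_sub, pow_succ']
    exact mul_dvd_mul (hg i) (ih (i + 1))

end PowerSeries

/-! ### The tails and their invariance under inverting the rank variable -/

open PowerSeries LaurentPolynomial

/-- The variable `z` marking the rank, in power series over Laurent polynomials. -/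
noncomputable abbrev rankVar : PowerSeries (LaurentPolynomial ℤ) := PowerSeries.C (T 1)

/-- The inverse `z⁻¹` of the variable marking the rank. -/
noncomputable abbrev rankVarInv : PowerSeries (LaurentPolynomial ℤ) := PowerSeries.C (T (-1))

theorem rankVar_mul_inv : rankVar * rankVarInv = 1 := by
  rw [← map_mul, ← T_add]; simp

theorem C_T_natCast (n : ℕ) :
    (PowerSeries.C (T n) : PowerSeries (LaurentPolynomial ℤ)) = rankVar ^ n := by
  rw [← map_pow, T_pow, mul_one]

theorem prod_T {ι : Type*} (s : Finset ι) (f : ι → ℤ) :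
    ∏ i ∈ s, (T (f i) : LaurentPolynomial ℤ) = T (∑ i ∈ s, f i) := by
  classical
  induction s using Finset.induction_on with
  | empty => simp
  | insert a s ha ih => rw [Finset.prod_insert ha, Finset.sum_insert ha, ih, T_add]

theorem coeff_sum_T {ι : Type*} [Fintype ι] (f : ι → ℤ) (m : ℤ) :
    (∑ l, (T (f l) : LaurentPolynomial ℤ)).coeff m = Fintype.card {l // f l = m} := by
  classical
  rw [Fintype.card_subtype]
  simp [Finset.sum_boole]

section Tails

variable {R : Type*} [CommRing R]

/-- The tails, in Fine's recursion, of the generating function of the `D`-rank. Here `z` marks the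
rank and `w` is its inverse. -/
noncomputable def dTail (z w : PowerSeries R) (i : ℕ) : PowerSeries R :=
  hyperSum X (-(w * X)) 0 (w * X ^ (i + 1)) 0 (z * X ^ (i + 1))

/-- The tails of the generating function of the `M₂`-rank. -/
noncomputable def m2Tail (z w : PowerSeries R) (i : ℕ) : PowerSeries R :=
  hyperSum (X ^ 2) (-(w * X)) (-(w * X ^ 2)) (w * X ^ (2 * i + 2)) X (z * X ^ (2 * i + 2))

theorem X_dvd_mul_X_pow (a : PowerSeries R) (i : ℕ) : X ∣ a * X ^ (i + 1) :=
  (dvd_pow_self X (Nat.succ_ne_zero i)).mul_left a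

/-- The shift `D ↦ D p`, `t ↦ t p` of `hyperSum_recursion` raises `i` by one. In the coefficient of
the next tail `z` and `w` occur only through `z * w = 1`, which makes the recursion symmetric. -/
theorem dTail_recursion {z w : PowerSeries R} (h : z * w = 1) (i : ℕ) :
    (1 - w * X ^ (i + 1)) * (1 - z * X ^ (i + 1)) * dTail z w i =
      1 + X ^ (i + 2) * (1 + X ^ (i + 1)) * dTail z w (i + 1) := by
  have e1 : 0 + z * X ^ (i + 1) * (w * X ^ (i + 1)) * X - z * X ^ (i + 1) * -(w * X) -
      z * X ^ (i + 1) * 0 = X ^ (i + 2) * (1 + X ^ (i + 1)) := by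
    linear_combination (X ^ (i + 2) * (1 + X ^ (i + 1))) * h
  rw [dTail, hyperSum_recursion (X_dvd_mul_X_pow _ _) (dvd_zero X) (X_dvd_mul_X_pow _ _) (by simp),
    dTail, e1, mul_assoc w, mul_assoc z, ← pow_succ]

theorem m2Tail_recursion {z w : PowerSeries R} (h : z * w = 1) (i : ℕ) :
    (1 - w * X ^ (2 * i + 2)) * (1 - z * X ^ (2 * i + 2)) * m2Tail z w i =
      1 + X * (1 + X ^ (2 * i + 2)) * (1 + X ^ (2 * i + 3)) * m2Tail z w (i + 1) := by
  have e1 : X + z * X ^ (2 * i + 2) * (w * X ^ (2 * i + 2)) * X ^ 2 -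
      z * X ^ (2 * i + 2) * -(w * X) - z * X ^ (2 * i + 2) * -(w * X ^ 2) =
        X * (1 + X ^ (2 * i + 2)) * (1 + X ^ (2 * i + 3)) := by
    linear_combination (X ^ (4 * i + 6) + X ^ (2 * i + 3) + X ^ (2 * i + 4)) * h
  rw [m2Tail, hyperSum_recursion (X_dvd_mul_X_pow _ _) (dvd_refl X) (X_dvd_mul_X_pow _ _)
    (by linear_combination (w * X ^ (2 * i + 5)) * h), m2Tail, e1, mul_assoc w, mul_assoc z,
    ← pow_add, show 2 * i + 2 + 2 = 2 * (i + 1) + 2 by ring]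

end Tails

/-- The involution of power series over Laurent polynomials inverting the rank variable. -/
noncomputable def invertRank :
    PowerSeries (LaurentPolynomial ℤ) →+* PowerSeries (LaurentPolynomial ℤ) :=
  PowerSeries.map (invert (R := ℤ) : LaurentPolynomial ℤ →+* LaurentPolynomial ℤ)

@[simp] theorem invertRank_X : invertRank X = X := PowerSeries.map_X _

@[simp] theorem invertRank_rankVar : invertRank rankVar = rankVarInv := by
  simp [invertRank]

@[simp] theorem invertRank_rankVarInv : invertRank rankVarInv = rankVar := by
  simp [invertRank]

theorem coeff_invertRank (f : PowerSeries (LaurentPolynomial ℤ)) (n : ℕ) (m : ℤ) :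
    (PowerSeries.coeff n (invertRank f)).coeff m = (PowerSeries.coeff n f).coeff (-m) := by
  simp [invertRank, invert_apply]

theorem invertRank_dTail (i : ℕ) :
    invertRank (dTail rankVar rankVarInv i) = dTail rankVar rankVarInv i := by
  refine fixed_of_recursion
    (fun i => (isUnit_one_sub (X_dvd_mul_X_pow rankVarInv i)).mul
      (isUnit_one_sub (X_dvd_mul_X_pow rankVar i)))
    (fun i => (dvd_pow_self X (Nat.succ_ne_zero (i + 1))).mul_right _) (fun i => ?_) (fun i => ?_)
    (dTail_recursion rankVar_mul_inv) i
  · simp only [map_mul, map_sub, map_pow, map_one, invertRank_X, invertRank_rankVar,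
      invertRank_rankVarInv, mul_comm (1 - rankVar * _)]
  · simp only [map_mul, map_add, map_pow, map_one, invertRank_X]

theorem invertRank_m2Tail (i : ℕ) :
    invertRank (m2Tail rankVar rankVarInv i) = m2Tail rankVar rankVarInv i := by
  refine fixed_of_recursion
    (fun i => (isUnit_one_sub (X_dvd_mul_X_pow rankVarInv (2 * i + 1))).mul
      (isUnit_one_sub (X_dvd_mul_X_pow rankVar (2 * i + 1))))
    (fun i => ((dvd_refl X).mul_right _).mul_right _) (fun i => ?_) (fun i => ?_)
    (m2Tail_recursion rankVar_mul_inv) i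
  · simp only [map_mul, map_sub, map_pow, map_one, invertRank_X, invertRank_rankVar,
      invertRank_rankVarInv, mul_comm (1 - rankVar * _)]
  · simp only [map_mul, map_add, map_pow, map_one, invertRank_X]

/-! ### The rank generating functions as hypergeometric series -/

theorem sum_range_two_mul {M : Type*} [AddCommMonoid M] (f : ℕ → M) (n : ℕ) :
    ∑ i ∈ Finset.range (2 * n), f i = ∑ i ∈ Finset.range n, (f (2 * i) + f (2 * i + 1)) := by
  induction n with
  | zero => simp
  | succ n ih =>
    rw [Finset.sum_range_succ, ← ih, mul_add_one, Finset.sum_range_succ, Finset.sum_range_succ,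
      add_assoc]

theorem prod_range_two_mul {M : Type*} [CommMonoid M] (f : ℕ → M) (n : ℕ) :
    ∏ i ∈ Finset.range (2 * n), f i = ∏ i ∈ Finset.range n, (f (2 * i) * f (2 * i + 1)) := by
  induction n with
  | zero => simp
  | succ n ih =>
    rw [Finset.prod_range_succ, ← ih, mul_add_one, Finset.prod_range_succ, Finset.prod_range_succ,
      mul_assoc]

/-- `partSeries` of a geometric weight in closed form. -/
theorem partSeries_eq (i : ℕ) (g : ℕ → LaurentPolynomial ℤ) (k a : LaurentPolynomial ℤ)
    (hg : ∀ c, c ≠ 0 → g c = k * a ^ c) :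
    partSeries (i + 1) g =
      oneSubInv (PowerSeries.C a * X ^ (i + 1)) * (PowerSeries.C (k * a) * X ^ (i + 1)) :=
  eq_oneSubInv_mul (X_dvd_mul_X_pow _ _) (partSeries_geometric (Nat.succ_ne_zero i) g k a hg)

section Terms

variable {R : Type*} [CommRing R]

theorem oneSubInv_zero : (oneSubInv 0 : PowerSeries R) = 1 := by
  simpa using one_sub_mul_oneSubInv (dvd_zero (X : PowerSeries R))

/-- A series with terms divisible by `X ^ r`, multiplied by `X`, agrees up to the coefficient of
`X ^ n` with the sum of its first `n` terms. -/
theorem coeff_one_add_sum {a b : ℕ → PowerSeries R} {c : PowerSeries R} (n : ℕ)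
    (ha : ∀ r, X ^ r ∣ a r) (h : ∀ r, b r = X * c * a r) :
    PowerSeries.coeff n (1 + ∑ r ∈ Finset.range n, b r) =
      PowerSeries.coeff n (1 + X * c * limSum a) := by
  simp_rw [h, ← Finset.mul_sum]
  symm
  rw [← sub_eq_zero, ← map_sub, add_sub_add_left_eq_sub, ← mul_sub, mul_assoc]
  refine X_pow_dvd_iff.1 ?_ n n.lt_succ_self
  rw [pow_succ']
  exact mul_dvd_mul_left X ((X_pow_dvd_limSum_sub ha n).mul_left c)

theorem dTerm_eq {z w : PowerSeries R} (h : z * w = 1) (N : ℕ) :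
    z ^ (N + 1) * ((∏ i ∈ Finset.range N,
        (oneSubInv (w * X ^ (i + 1)) * (1 + w * X ^ (i + 1)))) *
          (oneSubInv (w * X ^ (N + 1)) * (2 * w * X ^ (N + 1)))) =
      X * 2 * hyperTerm X (-(w * X)) 0 (w * X ^ (0 + 1)) 0 (z * X ^ (0 + 1)) N := by
  have e1 : ∀ j : ℕ, w * X ^ (0 + 1) * X ^ j = w * X ^ (j + 1) := by intro j; ring
  have e2 : ∀ j : ℕ, 1 - -(w * X) * X ^ j = 1 + w * X ^ (j + 1) := by intro j; ring
  simp only [hyperTerm, e1, e2, oneSubInv_zero, zero_mul, sub_zero, mul_one,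
    Finset.prod_mul_distrib, Finset.prod_range_succ]
  generalize ∏ j ∈ Finset.range N, oneSubInv (w * X ^ (j + 1)) = P
  generalize ∏ j ∈ Finset.range N, (1 + w * X ^ (j + 1)) = Q
  generalize oneSubInv (w * X ^ (N + 1)) = y
  linear_combination (2 * z ^ N * X ^ (N + 1) * P * Q * y) * h

/-- Largest parts `2N + 1` and `2N + 2` have the same half rounded up, so they are grouped. Their
sum becomes a single term because `(1 - w q^(2N+2)) + q (1 + w q^(2N+1)) = 1 + q`. -/
theorem m2Term_eq {z w : PowerSeries R} (h : z * w = 1) (N : ℕ) {P : PowerSeries R}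
    (hP : P = ∏ i ∈ Finset.range N,
        (oneSubInv (X ^ (2 * i + 1)) * (1 + w * X ^ (2 * i + 1))) *
        (oneSubInv (w * X ^ (2 * i + 2)) * (1 + w * X ^ (2 * i + 2)))) :
    z ^ (N + 1) * (P * (oneSubInv (X ^ (2 * N + 1)) * (2 * w * X ^ (2 * N + 1)))) +
      z ^ (N + 1) * (P * (oneSubInv (X ^ (2 * N + 1)) * (1 + w * X ^ (2 * N + 1))) *
        (oneSubInv (w * X ^ (2 * N + 2)) * (2 * w * X ^ (2 * N + 2)))) =
      X * (2 * (1 + X)) * hyperTerm (X ^ 2) (-(w * X)) (-(w * X ^ 2)) (w * X ^ (2 * 0 + 2)) X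
        (z * X ^ (2 * 0 + 2)) N := by
  have e1 : ∀ j : ℕ, w * X ^ (2 * 0 + 2) * (X ^ 2) ^ j = w * X ^ (2 * j + 2) := by intro j; ring
  have e2 : ∀ j : ℕ, 1 - -(w * X) * (X ^ 2) ^ j = 1 + w * X ^ (2 * j + 1) := by intro j; ring
  have e3 : ∀ j : ℕ, 1 - -(w * X ^ 2) * (X ^ 2) ^ j = 1 + w * X ^ (2 * j + 2) := by intro j; ring
  have e4 : ∀ j : ℕ, (X : PowerSeries R) * (X ^ 2) ^ j = X ^ (2 * j + 1) := by intro j; ring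
  have ey := one_sub_mul_oneSubInv (X_dvd_mul_X_pow w (2 * N + 1))
  rw [hP]
  simp only [hyperTerm, e1, e2, e3, e4, Finset.prod_mul_distrib, Finset.prod_range_succ]
  rw [show 2 * N + 1 + 1 = 2 * N + 2 from rfl] at ey
  generalize ∏ j ∈ Finset.range N, oneSubInv (w * X ^ (2 * j + 2)) = P1
  generalize ∏ j ∈ Finset.range N, oneSubInv ((X : PowerSeries R) ^ (2 * j + 1)) = P2
  generalize ∏ j ∈ Finset.range N, (1 + w * X ^ (2 * j + 1)) = P3
  generalize ∏ j ∈ Finset.range N, (1 + w * X ^ (2 * j + 2)) = P4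
  generalize oneSubInv (w * X ^ (2 * N + 2)) = y at *
  generalize oneSubInv ((X : PowerSeries R) ^ (2 * N + 1)) = x
  linear_combination (2 * z ^ N * X ^ (2 * N + 1) * (1 + X) * P1 * P2 * P3 * P4 * x * y) * h -
    (2 * z ^ (N + 1) * w * X ^ (2 * N + 1) * P1 * P2 * P3 * P4 * x) * ey

end Terms

namespace Overpartition

theorem sum_T_dRank (n : ℕ) :
    ∑ l : Overpartition n, (T l.dRank : LaurentPolynomial ℤ) =
      PowerSeries.coeff n (1 + X * 2 * dTail rankVar rankVarInv 0) := by
  rw [sum_eq_coeff (fun _ _ c _ => T (-(c : ℤ))) (fun N => T ((N + 1 : ℕ) : ℤ)) _ ?_ ?_ le_rfl]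
  · have hS : ∀ i : ℕ, (partSeries (i + 1) fun c => T (-(c : ℤ)) + T (-(c : ℤ))) =
        oneSubInv (rankVarInv * X ^ (i + 1)) * (2 * rankVarInv * X ^ (i + 1)) := by
      intro i
      rw [partSeries_eq i _ 2 (T (-1)) (fun c _ => by rw [T_pow]; ring_nf), map_mul, map_ofNat]
    have hS' : ∀ i : ℕ, (1 + partSeries (i + 1) fun c => T (-(c : ℤ)) + T (-(c : ℤ))) =
        oneSubInv (rankVarInv * X ^ (i + 1)) * (1 + rankVarInv * X ^ (i + 1)) := by
      intro i
      rw [hS]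
      linear_combination (-1 : PowerSeries (LaurentPolynomial ℤ)) *
        one_sub_mul_oneSubInv (X_dvd_mul_X_pow rankVarInv i)
    simp only [hS']
    simp only [hS, C_T_natCast]
    rw [dTail, hyperSum]
    exact coeff_one_add_sum n (X_pow_dvd_hyperTerm (X_dvd_mul_X_pow _ _))
      (dTerm_eq rankVar_mul_inv)
  · intro l h
    simp [dRank, h, length, parts_eq_zero l h]
  · intro N l h
    rw [weight, prod_T, ← T_add, dRank, h, Finset.sum_neg_distrib, ← Nat.cast_sum, length,
      Multiset.toFinset_sum_count_eq]
    rfl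

/-- The contribution of the part size `i` to the `M₂`-rank of an overpartition with largest part
`N + 1`, when `i` has multiplicity `c` and `b` says whether its first occurrence is overlined. -/
def m2Contribution (N i c : ℕ) (b : Bool) : ℤ :=
  -(c : ℤ) + (if Odd i then (c : ℤ) - (if b then 1 else 0) else 0) -
    (if i = N + 1 ∧ Odd i ∧ b = false then 1 else 0)

/-- Once the largest part is fixed, the rest of the rank is additive over part sizes, `chi`
included, so `T` of it is a multiplicative weight. -/
theorem m2Rank_eq {N n : ℕ} (l : Overpartition n) (h : l.largest = N + 1) :
    l.m2Rank = ((N / 2 + 1 : ℕ) : ℤ) + ∑ i ∈ l.parts.toFinset,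
      m2Contribution N i (l.parts.count i) (decide (i ∈ l.overlined)) := by
  have hceil : ⌈((N + 1 : ℕ) : ℚ) / 2⌉ = ((N / 2 + 1 : ℕ) : ℤ) := by
    obtain ⟨k, rfl | rfl⟩ : ∃ k, N = 2 * k ∨ N = 2 * k + 1 := ⟨N / 2, by omega⟩
    · rw [Int.ceil_eq_iff, show 2 * k / 2 + 1 = k + 1 by omega]
      push_cast
      constructor <;> linarith
    · rw [Int.ceil_eq_iff, show (2 * k + 1) / 2 + 1 = k + 1 by omega]
      push_cast
      constructor <;> linarith
  have hodd : (l.nonOverlinedOdd.card : ℤ) = ∑ i ∈ l.parts.toFinset,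
      (if Odd i then (l.parts.count i : ℤ) - (if decide (i ∈ l.overlined) then 1 else 0)
        else 0) := by
    rw [← Multiset.sum_count_eq_card (s := l.parts.toFinset)]
    · push_cast
      refine Finset.sum_congr rfl fun i hi => ?_
      rw [nonOverlinedOdd, Multiset.count_filter, nonOverlined, Multiset.count_sub]
      have h1 : 1 ≤ l.parts.count i := Multiset.one_le_count_iff_mem.2 (Multiset.mem_toFinset.1 hi)
      rw [Multiset.count_eq_of_nodup l.overlined.nodup]
      by_cases hm : i ∈ l.overlined <;> by_cases ho : Odd i <;> simp [hm, ho, h1]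
    · intro i hi
      exact Multiset.mem_toFinset.2
        (Multiset.mem_of_le (Multiset.sub_le_self _ _) (Multiset.mem_of_mem_filter hi))
  have hchi : l.chi = ∑ i ∈ l.parts.toFinset,
      (if i = N + 1 ∧ Odd i ∧ decide (i ∈ l.overlined) = false then (1 : ℤ) else 0) := by
    rw [Finset.sum_eq_single (N + 1)]
    · simp [chi, h]
    · intro i _ hi
      simp [hi]
    · intro hN
      exact absurd (Multiset.mem_toFinset.2 (l.largest_mem h)) hN
  have hlen : (l.length : ℤ) = ∑ i ∈ l.parts.toFinset, (l.parts.count i : ℤ) := by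
    rw [← Nat.cast_sum, Multiset.toFinset_sum_count_eq, length]
  simp only [m2Contribution, Finset.sum_sub_distrib, Finset.sum_add_distrib,
    Finset.sum_neg_distrib]
  rw [m2Rank, h, hceil, hodd, hchi, hlen]
  ring

theorem sum_T_m2Rank (n : ℕ) :
    ∑ l : Overpartition n, (T l.m2Rank : LaurentPolynomial ℤ) =
      PowerSeries.coeff n (1 + X * (2 * (1 + X)) * m2Tail rankVar rankVarInv 0) := by
  -- The bound `2 * n` is even, so the largest parts can be taken in pairs.
  rw [sum_eq_coeff (fun N i c b => T (m2Contribution N i c b)) (fun N => T ((N / 2 + 1 : ℕ) : ℤ)) _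
    ?_ ?_ (show n ≤ 2 * n by omega)]
  · have hodd : ∀ N i : ℕ, 2 * i ≠ N → (1 + partSeries (2 * i + 1) fun c =>
        T (m2Contribution N (2 * i + 1) c true) + T (m2Contribution N (2 * i + 1) c false)) =
          oneSubInv (X ^ (2 * i + 1)) * (1 + rankVarInv * X ^ (2 * i + 1)) := by
      intro N i hi
      rw [partSeries_eq (2 * i) _ (T (-1) + 1) 1
        (fun c _ => by
          rw [one_pow, mul_one]
          congr 2
          · simp [m2Contribution]
            omega
          · simp [m2Contribution, hi])]
      have := one_sub_mul_oneSubInv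
        (dvd_pow_self (X : PowerSeries (LaurentPolynomial ℤ)) (show 2 * i + 1 ≠ 0 by omega))
      rw [map_one, one_mul, mul_one, map_add, map_one]
      linear_combination -this
    -- For the largest part, `chi` makes the non-overlined case contribute `-1` as well, just like
    -- the overlined one; hence the factor `2 * rankVarInv`.
    have hoddTop : ∀ i : ℕ, (partSeries (2 * i + 1) fun c =>
        T (m2Contribution (2 * i) (2 * i + 1) c true) +
          T (m2Contribution (2 * i) (2 * i + 1) c false)) =
          oneSubInv (X ^ (2 * i + 1)) * (2 * rankVarInv * X ^ (2 * i + 1)) := by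
      intro i
      rw [partSeries_eq (2 * i) _ (2 * T (-1)) 1
        (fun c _ => by
          simp [m2Contribution, two_mul]
          congr 1
          ring), map_one, one_mul, mul_one, map_mul, map_ofNat]
    have heven' : ∀ N i : ℕ, (partSeries (2 * i + 1 + 1) fun c =>
        T (m2Contribution N (2 * i + 1 + 1) c true) +
          T (m2Contribution N (2 * i + 1 + 1) c false)) =
          oneSubInv (rankVarInv * X ^ (2 * i + 2)) * (2 * rankVarInv * X ^ (2 * i + 2)) := by
      intro N i
      have ho : ¬ Odd (2 * i + 1 + 1) := by
        rw [Nat.not_odd_iff_even]; exact ⟨i + 1, by ring⟩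
      rw [partSeries_eq (2 * i + 1) _ 2 (T (-1))
        (fun c _ => by simp only [m2Contribution, ho, T_pow]; simp; ring), map_mul, map_ofNat]
    have heven : ∀ N i : ℕ, (1 + partSeries (2 * i + 1 + 1) fun c =>
        T (m2Contribution N (2 * i + 1 + 1) c true) +
          T (m2Contribution N (2 * i + 1 + 1) c false)) =
          oneSubInv (rankVarInv * X ^ (2 * i + 2)) * (1 + rankVarInv * X ^ (2 * i + 2)) := by
      intro N i
      rw [heven']
      linear_combination (-1 : PowerSeries (LaurentPolynomial ℤ)) *
        one_sub_mul_oneSubInv (X_dvd_mul_X_pow rankVarInv (2 * i + 1))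
    rw [sum_range_two_mul, m2Tail, hyperSum]
    refine coeff_one_add_sum n (X_pow_dvd_hyperTerm (X_dvd_mul_X_pow _ _)) fun N => ?_
    have hprod : ∀ M, 2 * N ≤ M → ∏ i ∈ Finset.range (2 * N), (1 + partSeries (i + 1) fun c =>
        T (m2Contribution M (i + 1) c true) + T (m2Contribution M (i + 1) c false)) =
        ∏ i ∈ Finset.range N,
          (oneSubInv (X ^ (2 * i + 1)) * (1 + rankVarInv * X ^ (2 * i + 1))) *
          (oneSubInv (rankVarInv * X ^ (2 * i + 2)) * (1 + rankVarInv * X ^ (2 * i + 2))) := by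
      intro M hM
      rw [prod_range_two_mul]
      refine Finset.prod_congr rfl fun i hi => ?_
      have := Finset.mem_range.1 hi
      rw [heven, hodd _ _ (by omega)]
    rw [← m2Term_eq rankVar_mul_inv N rfl, Finset.prod_range_succ, hprod _ le_rfl,
      hprod _ (Nat.le_succ _), hodd _ _ (by omega), hoddTop, heven', C_T_natCast, C_T_natCast,
      show 2 * N / 2 + 1 = N + 1 by omega, show (2 * N + 1) / 2 + 1 = N + 1 by omega]
  · intro l h
    have : l.overlined = ∅ := by
      rw [← Finset.subset_empty]
      have := l.overlined_subset
      rwa [show l.toPartition.parts = 0 from parts_eq_zero l h] at this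
    simp [m2Rank, chi, h, length, nonOverlinedOdd, nonOverlined, parts_eq_zero l h]
  · intro N l h
    rw [weight, prod_T, ← T_add, m2Rank_eq l h]

end Overpartition

/-! ### Symmetry of both rank counts -/

theorem overN_eq_coeff (m : ℤ) (n : ℕ) : (overN m n : ℤ) =
    (PowerSeries.coeff n (1 + X * 2 * dTail rankVar rankVarInv 0)).coeff m := by
  rw [← Overpartition.sum_T_dRank, coeff_sum_T]
  rfl

theorem overN2_eq_coeff (m : ℤ) (n : ℕ) : (overN2 m n : ℤ) =
    (PowerSeries.coeff n (1 + X * (2 * (1 + X)) * m2Tail rankVar rankVarInv 0)).coeff m := by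
  rw [← Overpartition.sum_T_m2Rank, coeff_sum_T]
  rfl

theorem overN_neg (m n : ℤ) : overN (-m) n = overN m n := by
  cases n with
  | negSucc n => rfl
  | ofNat n =>
    zify
    rw [Int.ofNat_eq_natCast, overN_eq_coeff, overN_eq_coeff, ← coeff_invertRank]
    simp only [map_add, map_mul, map_one, map_ofNat, invertRank_X, invertRank_dTail]

theorem overN2_neg (m n : ℤ) : overN2 (-m) n = overN2 m n := by
  cases n with
  | negSucc n => rfl
  | ofNat n =>
    zify
    rw [Int.ofNat_eq_natCast, overN2_eq_coeff, overN2_eq_coeff, ← coeff_invertRank]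
    simp only [map_add, map_mul, map_one, map_ofNat, invertRank_X, invertRank_m2Tail]

/-! ### Monotonicity for the `M₂`-rank -/

namespace Overpartition

/-- Adjoin a non-overlined part `1`. -/
def addOne {n : ℕ} (l : Overpartition n) : Overpartition (n + 1) where
  toPartition :=
    { parts := 1 ::ₘ l.toPartition.parts
      parts_pos := by
        intro i hi
        rcases Multiset.mem_cons.1 hi with rfl | hi
        · exact one_pos
        · exact l.toPartition.parts_pos hi
      parts_sum := by rw [Multiset.sum_cons, l.toPartition.parts_sum, add_comm] }
  overlined := l.overlined
  overlined_subset := l.overlined_subset.trans (Multiset.toFinset_subset.2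
    (Multiset.subset_cons _ _))

theorem addOne_injective (n : ℕ) : Function.Injective (addOne (n := n)) := by
  intro l l' h
  have h1 : 1 ::ₘ l.toPartition.parts = 1 ::ₘ l'.toPartition.parts :=
    congrArg (fun x : Overpartition (n + 1) => x.toPartition.parts) h
  have h2 : l.overlined = l'.overlined :=
    congrArg (fun x : Overpartition (n + 1) => x.overlined) h
  exact Overpartition.ext (Nat.Partition.ext ((Multiset.cons_inj_right 1).1 h1)) h2

theorem parts_addOne {n : ℕ} (l : Overpartition n) : l.addOne.parts = 1 ::ₘ l.parts := rfl

theorem card_nonOverlinedOdd_addOne {n : ℕ} (l : Overpartition n) :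
    l.addOne.nonOverlinedOdd.card = l.nonOverlinedOdd.card + 1 := by
  have hle : l.overlined.val ≤ l.parts :=
    (Multiset.le_iff_subset l.overlined.nodup).2 fun i hi =>
      Multiset.mem_toFinset.1 (l.overlined_subset hi)
  have : l.addOne.nonOverlined = 1 ::ₘ l.nonOverlined := by
    rw [nonOverlined, parts_addOne, nonOverlined]
    exact Multiset.cons_sub_of_le 1 hle
  rw [nonOverlinedOdd, this, Multiset.filter_cons_of_pos _ odd_one, Multiset.card_cons,
    nonOverlinedOdd]

/-- The new part raises both the length and the number of non-overlined odd parts by one. Only for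
the empty overpartition does the largest part change; there the new half, rounded up, is cancelled
by `chi`. -/
theorem m2Rank_addOne {n : ℕ} (l : Overpartition n) : l.addOne.m2Rank = l.m2Rank := by
  have hlen : l.addOne.length = l.length + 1 := Multiset.card_cons _ _
  have hlar : l.addOne.largest = max 1 l.largest := Multiset.sup_cons _ _
  have hover : l.addOne.overlined = l.overlined := rfl
  rw [m2Rank, m2Rank, hlen, card_nonOverlinedOdd_addOne, chi, chi, hlar, hover]
  rcases Nat.eq_zero_or_pos l.largest with h | h
  · have h1 : 1 ∉ l.overlined := fun h1 => by
      have := Multiset.mem_toFinset.1 (l.overlined_subset h1)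
      rw [show l.toPartition.parts = 0 from l.parts_eq_zero h] at this
      simp at this
    have hc : ⌈((1 : ℕ) : ℚ) / 2⌉ = 1 := by
      rw [Int.ceil_eq_iff]
      norm_num
    rw [h, max_eq_left zero_le_one, hc]
    simp [h1]
    ring
  · rw [max_eq_right h]
    push_cast
    ring

end Overpartition

theorem overN2_mono (m : ℤ) (n : ℕ) : overN2 m ((n : ℤ) - 1) ≤ overN2 m n := by
  cases n with
  | zero => exact Nat.zero_le _
  | succ n =>
    rw [Nat.cast_succ, add_sub_cancel_right]
    exact Fintype.card_le_of_injective
      (fun l : {l : Overpartition n // l.m2Rank = m} =>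
        (⟨l.1.addOne, l.1.m2Rank_addOne.trans l.2⟩ : {l : Overpartition (n + 1) // l.m2Rank = m}))
      fun l l' h => Subtype.ext (Overpartition.addOne_injective n (congrArg Subtype.val h))

/-! ### Coefficientwise nonnegativity -/

/-- The coefficient of `z ^ m q ^ n`. -/
noncomputable def rankCoeff (m : ℤ) (n : ℕ) :
    PowerSeries (LaurentPolynomial ℤ) →+ ℤ where
  toFun f := (PowerSeries.coeff n f).coeff m
  map_zero' := by simp
  map_add' f g := by simp

theorem rankCoeff_X_mul (m : ℤ) (n : ℕ) (f : PowerSeries (LaurentPolynomial ℤ)) :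
    rankCoeff m (n + 1) (X * f) = rankCoeff m n f :=
  congrArg (fun p : LaurentPolynomial ℤ => p.coeff m) (PowerSeries.coeff_succ_X_mul n f)

theorem rankCoeff_zero_X_mul (m : ℤ) (f : PowerSeries (LaurentPolynomial ℤ)) :
    rankCoeff m 0 (X * f) = 0 := by
  simp [rankCoeff]

theorem rankCoeff_one (m : ℤ) (n : ℕ) : rankCoeff m n 1 = if n = 0 ∧ m = 0 then 1 else 0 := by
  by_cases hn : n = 0 <;> simp [rankCoeff, PowerSeries.coeff_one, hn, ← T_zero, eq_comm]

theorem rankCoeff_T_mul_X_pow_self (m : ℤ) (n : ℕ) :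
    rankCoeff m n (PowerSeries.C (T m) * X ^ n) = 1 := by
  simp [rankCoeff, PowerSeries.coeff_C_mul, PowerSeries.coeff_X_pow]

/-- Coefficientwise nonnegativity. -/
def CoeffNonneg (f : PowerSeries (LaurentPolynomial ℤ)) : Prop := ∀ m n, 0 ≤ rankCoeff m n f

theorem LaurentPolynomial.coeff_mul_nonneg {a b : LaurentPolynomial ℤ} (ha : ∀ m, 0 ≤ a.coeff m)
    (hb : ∀ m, 0 ≤ b.coeff m) (m : ℤ) : 0 ≤ (a * b).coeff m := by
  classical
  rw [AddMonoidAlgebra.coeff_mul]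
  refine Finset.sum_nonneg fun i _ => Finset.sum_nonneg fun j _ => ?_
  dsimp only
  split_ifs
  · exact mul_nonneg (ha i) (hb j)
  · exact le_rfl

namespace CoeffNonneg

variable {f g f' g' u : PowerSeries (LaurentPolynomial ℤ)}

theorem add (hf : CoeffNonneg f) (hg : CoeffNonneg g) : CoeffNonneg (f + g) :=
  fun m n => by rw [map_add]; exact add_nonneg (hf m n) (hg m n)

theorem mul (hf : CoeffNonneg f) (hg : CoeffNonneg g) : CoeffNonneg (f * g) := by
  intro m n
  change 0 ≤ (PowerSeries.coeff n (f * g)).coeff m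
  rw [PowerSeries.coeff_mul, AddMonoidAlgebra.coeff_sum, Finset.sum_apply']
  exact Finset.sum_nonneg fun i _ =>
    LaurentPolynomial.coeff_mul_nonneg (fun m => hf m i.1) (fun m => hg m i.2) m

theorem one : CoeffNonneg 1 := fun m n => by
  rw [rankCoeff_one]; positivity

theorem pow (hf : CoeffNonneg f) (n : ℕ) : CoeffNonneg (f ^ n) := by
  induction n with
  | zero => rw [pow_zero]; exact one
  | succ n ih => rw [pow_succ]; exact ih.mul hf

theorem prod {ι : Type*} {s : Finset ι} {F : ι → PowerSeries (LaurentPolynomial ℤ)}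
    (h : ∀ i ∈ s, CoeffNonneg (F i)) : CoeffNonneg (∏ i ∈ s, F i) :=
  Finset.prod_induction F CoeffNonneg (fun _ _ => mul) one h

theorem X : CoeffNonneg X := by
  intro m n
  cases n with
  | zero => rw [← mul_one PowerSeries.X, rankCoeff_zero_X_mul]
  | succ n => rw [← mul_one PowerSeries.X, rankCoeff_X_mul]; exact one m n

theorem C_T (a : ℤ) : CoeffNonneg (PowerSeries.C (T a)) := by
  intro m n
  change 0 ≤ (PowerSeries.coeff n (PowerSeries.C (T a))).coeff m
  rw [PowerSeries.coeff_C]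
  split_ifs
  · rw [T_apply]; positivity
  · simp

theorem le (h : CoeffNonneg (g - f)) (m : ℤ) (n : ℕ) : rankCoeff m n f ≤ rankCoeff m n g := by
  have := h m n
  rw [map_sub] at this
  linarith

theorem mul_sub_mul (hf : CoeffNonneg f) (hg : CoeffNonneg g') (hff' : CoeffNonneg (f' - f))
    (hgg' : CoeffNonneg (g' - g)) : CoeffNonneg (f' * g' - f * g) := by
  rw [show f' * g' - f * g = (f' - f) * g' + f * (g' - g) by ring]
  exact (hff'.mul hg).add (hf.mul hgg')

/-- Since `u` has no constant term, `1 / (1 - u) = 1 + u / (1 - u)` expresses each coefficient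
through earlier ones. -/
theorem oneSubInv (hu : CoeffNonneg u) (h : PowerSeries.X ∣ u) :
    CoeffNonneg (PowerSeries.oneSubInv u) := by
  intro m n
  induction n using Nat.strong_induction_on generalizing m with
  | _ n ih =>
    rw [oneSubInv_eq h, map_add]
    refine add_nonneg (one m n) ?_
    change 0 ≤ (PowerSeries.coeff n (u * PowerSeries.oneSubInv u)).coeff m
    rw [PowerSeries.coeff_mul, AddMonoidAlgebra.coeff_sum, Finset.sum_apply']
    refine Finset.sum_nonneg fun i hi => ?_
    rw [Finset.HasAntidiagonal.mem_antidiagonal] at hi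
    rcases Nat.eq_zero_or_pos i.1 with h0 | h0
    · rw [h0, PowerSeries.coeff_zero_eq_constantCoeff_apply, X_dvd_iff.1 h, zero_mul]
      simp
    · exact LaurentPolynomial.coeff_mul_nonneg (fun m => hu m i.1)
        (fun m => ih i.2 (by omega) m) m

theorem oneSubInv_sub_pow (hu : CoeffNonneg u) (h : PowerSeries.X ∣ u) (j : ℕ) :
    CoeffNonneg (PowerSeries.oneSubInv u - u ^ j) := by
  induction j with
  | zero =>
    rw [oneSubInv_eq h, pow_zero, add_sub_cancel_left]
    exact hu.mul (hu.oneSubInv h)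
  | succ j ih =>
    rw [oneSubInv_eq h, pow_succ', add_sub_assoc, ← mul_sub]
    exact one.add (hu.mul ih)

theorem limSum {a : ℕ → PowerSeries (LaurentPolynomial ℤ)} (ha : ∀ r, CoeffNonneg (a r)) :
    CoeffNonneg (PowerSeries.limSum a) := by
  intro m n
  change 0 ≤ (PowerSeries.coeff n (PowerSeries.limSum a)).coeff m
  rw [PowerSeries.limSum, PowerSeries.coeff_mk, map_sum, AddMonoidAlgebra.coeff_sum,
    Finset.sum_apply']
  exact Finset.sum_nonneg fun r _ => ha r m n

theorem dTail (i : ℕ) : CoeffNonneg (dTail rankVar rankVarInv i) := by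
  refine limSum fun r => ((pow ((C_T 1).mul (X.pow _)) r).mul (prod fun j _ => ?_)).mul
    (prod fun j _ => ?_)
  · rw [neg_mul, sub_neg_eq_add, zero_mul, sub_zero, mul_one]
    exact one.add (((C_T (-1)).mul X).mul (X.pow j))
  · rw [zero_mul, oneSubInv_zero, mul_one]
    exact oneSubInv (((C_T (-1)).mul (X.pow _)).mul (X.pow j))
      ((X_dvd_mul_X_pow _ _).mul_right _)

end CoeffNonneg

/-! ### Monotonicity for the `D`-rank -/

/-- The series `1 / ((1 - q ^ (i + 1) / z) (1 - z q ^ (i + 1)))`. -/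
noncomputable def pairInv (i : ℕ) : PowerSeries (LaurentPolynomial ℤ) :=
  oneSubInv (rankVarInv * X ^ (i + 1)) * oneSubInv (rankVar * X ^ (i + 1))

/-- The series `∑ z ^ m q ^ |m|`, over all integers `m`. -/
noncomputable def absSeries : PowerSeries (LaurentPolynomial ℤ) :=
  oneSubInv (rankVarInv * X ^ (0 + 1)) +
    rankVar * X ^ (0 + 1) * oneSubInv (rankVar * X ^ (0 + 1))

theorem absSeries_eq : absSeries = (1 - X ^ 2) * pairInv 0 := by
  have h := rankVar_mul_inv
  have h1 := one_sub_mul_oneSubInv (X_dvd_mul_X_pow rankVarInv 0)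
  have h2 := one_sub_mul_oneSubInv (X_dvd_mul_X_pow rankVar 0)
  rw [absSeries, pairInv]
  generalize rankVarInv = w at *
  generalize rankVar = z at *
  generalize oneSubInv (w * X ^ (0 + 1)) = A at *
  generalize oneSubInv (z * X ^ (0 + 1)) = B at *
  linear_combination -X ^ 2 * A * B * h - z * X * B * h1 - A * h2

theorem dTail_eq (i : ℕ) : dTail rankVar rankVarInv i =
    pairInv i * (1 + X ^ (i + 2) * (1 + X ^ (i + 1)) * dTail rankVar rankVarInv (i + 1)) := by
  have h := dTail_recursion rankVar_mul_inv i
  rw [mul_assoc] at h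
  rw [eq_oneSubInv_mul (X_dvd_mul_X_pow _ _) (eq_oneSubInv_mul (X_dvd_mul_X_pow _ _) h), pairInv]
  ring

/-- The factor `1 + X` in the recursion at `i = 0` combines with `1 - X` to `1 - X ^ 2`, which turns
`pairInv 0` into the nonnegative `absSeries`. -/
theorem one_sub_X_mul_dTail_zero : (1 - X) * dTail rankVar rankVarInv 0 =
    (1 - X) * pairInv 0 + X * (X * (absSeries * dTail rankVar rankVarInv 1)) := by
  rw [dTail_eq 0, absSeries_eq]
  ring

namespace CoeffNonneg

theorem rankVar_mul (i : ℕ) : CoeffNonneg (rankVar * PowerSeries.X ^ i) := (C_T 1).mul (X.pow i)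

theorem rankVarInv_mul (i : ℕ) : CoeffNonneg (rankVarInv * PowerSeries.X ^ i) :=
  (C_T (-1)).mul (X.pow i)

theorem pairInv_sub (i b c : ℕ) : CoeffNonneg (pairInv i -
    (rankVarInv * PowerSeries.X ^ (i + 1)) ^ b * (rankVar * PowerSeries.X ^ (i + 1)) ^ c) :=
  mul_sub_mul ((rankVarInv_mul _).pow b) ((rankVar_mul _).oneSubInv (X_dvd_mul_X_pow _ _))
    ((rankVarInv_mul _).oneSubInv_sub_pow (X_dvd_mul_X_pow _ _) b)
    ((rankVar_mul _).oneSubInv_sub_pow (X_dvd_mul_X_pow _ _) c)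

theorem pairInv (i : ℕ) : CoeffNonneg (pairInv i) :=
  ((rankVarInv_mul _).oneSubInv (X_dvd_mul_X_pow _ _)).mul
    ((rankVar_mul _).oneSubInv (X_dvd_mul_X_pow _ _))

theorem absSeries : CoeffNonneg absSeries :=
  ((rankVarInv_mul _).oneSubInv (X_dvd_mul_X_pow _ _)).add ((rankVar_mul _).mul
    ((rankVar_mul _).oneSubInv (X_dvd_mul_X_pow _ _)))

theorem absSeries_sub (a : ℕ) :
    CoeffNonneg (_root_.absSeries - (rankVar * PowerSeries.X ^ (0 + 1)) ^ a) := by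
  have h := X_dvd_mul_X_pow rankVar 0
  have h' := X_dvd_mul_X_pow rankVarInv 0
  cases a with
  | zero =>
    rw [_root_.absSeries, add_sub_right_comm]
    have h0 := (rankVarInv_mul (0 + 1)).oneSubInv_sub_pow h' 0
    rw [pow_zero] at h0 ⊢
    exact h0.add ((rankVar_mul _).mul ((rankVar_mul _).oneSubInv h))
  | succ a =>
    rw [_root_.absSeries, add_sub_assoc,
      pow_succ' (rankVar * PowerSeries.X ^ (0 + 1)), ← mul_sub]
    exact ((rankVarInv_mul _).oneSubInv h').add
      ((rankVar_mul _).mul ((rankVar_mul _).oneSubInv_sub_pow h a))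

theorem dTail_sub (i b c : ℕ) : CoeffNonneg (_root_.dTail rankVar rankVarInv i -
    (rankVarInv * PowerSeries.X ^ (i + 1)) ^ b * (rankVar * PowerSeries.X ^ (i + 1)) ^ c) := by
  rw [dTail_eq, mul_add, mul_one, add_sub_right_comm]
  exact (pairInv_sub i b c).add
    ((pairInv i).mul (((X.pow _).mul (one.add (X.pow _))).mul (dTail (i + 1))))

end CoeffNonneg

/-- A monomial dominated by `absSeries * dTail 1`, with coefficient bound. -/
theorem one_le_rankCoeff_absSeries_mul (a b c : ℕ) :
    1 ≤ rankCoeff ((a : ℤ) + c - b) (a + 2 * b + 2 * c)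
      (absSeries * dTail rankVar rankVarInv 1) := by
  have h := CoeffNonneg.mul_sub_mul ((CoeffNonneg.rankVar_mul (0 + 1)).pow a) (CoeffNonneg.dTail 1)
    (CoeffNonneg.absSeries_sub a) (CoeffNonneg.dTail_sub 1 b c)
  refine le_trans (le_of_eq ?_) (h.le _ _)
  rw [← rankCoeff_T_mul_X_pow_self ((a : ℤ) + c - b) (a + 2 * b + 2 * c)]
  congr 1
  have e : (PowerSeries.C (T ((a : ℤ) + c - b)) : PowerSeries (LaurentPolynomial ℤ)) =
      rankVar ^ a * (rankVarInv ^ b * rankVar ^ c) := by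
    simp only [← map_pow, ← map_mul, T_pow, ← T_add]
    congr 2
    ring
  rw [e]
  generalize rankVarInv = w
  generalize rankVar = z
  ring

/-- The coefficient of `q ^ 5`, which is not covered by `one_le_rankCoeff_absSeries_mul`. -/
theorem one_le_rankCoeff_five :
    1 ≤ rankCoeff 0 5 (absSeries * dTail rankVar rankVarInv 1) := by
  set W := absSeries * (pairInv 1 * dTail rankVar rankVarInv 2) with hW
  have hW1 : CoeffNonneg (W - 1) := by
    have h2 := CoeffNonneg.dTail_sub 2 0 0
    have h1 := CoeffNonneg.pairInv_sub 1 0 0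
    have h0 := CoeffNonneg.absSeries_sub 0
    rw [pow_zero] at h0
    rw [pow_zero, pow_zero, mul_one] at h1 h2
    have := CoeffNonneg.mul_sub_mul CoeffNonneg.one
      ((CoeffNonneg.pairInv 1).mul (CoeffNonneg.dTail 2)) h0
      (CoeffNonneg.mul_sub_mul CoeffNonneg.one (CoeffNonneg.dTail 2) h1 h2)
    rwa [mul_one, mul_one] at this
  have hW0 : CoeffNonneg W := by
    have := hW1.add CoeffNonneg.one
    rwa [sub_add_cancel] at this
  have h : CoeffNonneg (absSeries * dTail rankVar rankVarInv 1 - PowerSeries.C (T 0) * X ^ 5) := by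
    rw [dTail_eq 1, T_zero, map_one, one_mul]
    have e : absSeries * (pairInv 1 * (1 + X ^ (1 + 2) * (1 + X ^ (1 + 1)) *
        dTail rankVar rankVarInv (1 + 1))) - X ^ 5 =
        -- The wanted monomial is the `X ^ 5` in `X ^ 3 * (1 + X ^ 2)` from one recursion step; it
        -- survives because `W - 1` is still nonnegative.
        absSeries * pairInv 1 + (X ^ 3 * W + X ^ 5 * (W - 1)) := by
      rw [hW]
      ring
    rw [e]
    exact (CoeffNonneg.absSeries.mul (CoeffNonneg.pairInv 1)).add
      (((CoeffNonneg.X.pow 3).mul hW0).add ((CoeffNonneg.X.pow 5).mul hW1))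
  exact (rankCoeff_T_mul_X_pow_self 0 5).symm.le.trans (h.le 0 5)

/-- The exponents solve `a + c - b = m` and `a + 2b + 2c = m + 1 + 2s`, according to the parity of
`s`. -/
theorem one_le_rankCoeff_absSeries_mul_dTail (m s : ℕ) (h : m ≠ 0 ∨ s ≠ 0) :
    1 ≤ rankCoeff m (m + 1 + 2 * s) (absSeries * dTail rankVar rankVarInv 1) := by
  obtain ⟨i, rfl | rfl⟩ : ∃ i, s = 2 * i ∨ s = 2 * i + 1 := ⟨s / 2, by omega⟩
  · rcases Nat.eq_zero_or_pos m with rfl | hm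
    · match i, h with
      -- For `m = 0` in degree `5` the system reduces to `3a + 4c = 5`, which has no solution in
      -- natural numbers.
      | 1, _ => exact one_le_rankCoeff_five
      | i + 2, _ =>
        convert one_le_rankCoeff_absSeries_mul 3 (i + 3) i using 2
        push_cast
        ring_nf
    · obtain ⟨m, rfl⟩ : ∃ k, m = k + 1 := ⟨m - 1, by omega⟩
      convert one_le_rankCoeff_absSeries_mul m i (i + 1) using 2
      push_cast
      ring_nf
  · convert one_le_rankCoeff_absSeries_mul (m + 1) (i + 1) i using 2
    push_cast
    ring_nf

theorem coeff_oneSubInv (a : ℤ) (n : ℕ) :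
    PowerSeries.coeff n (oneSubInv (PowerSeries.C (T a) * X ^ (0 + 1))) =
      (T (n * a) : LaurentPolynomial ℤ) := by
  induction n with
  | zero =>
    rw [oneSubInv_eq (X_dvd_mul_X_pow _ 0)]
    simp
  | succ n ih =>
    rw [oneSubInv_eq (X_dvd_mul_X_pow _ 0), map_add, zero_add, pow_one, mul_assoc,
      PowerSeries.coeff_C_mul, PowerSeries.coeff_succ_X_mul]
    rw [zero_add, pow_one] at ih
    rw [ih, ← T_add, PowerSeries.coeff_one, if_neg (Nat.succ_ne_zero n), zero_add]
    congr 1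
    push_cast
    ring

theorem rankCoeff_absSeries (m k : ℕ) :
    rankCoeff m k absSeries = if k = m then 1 else 0 := by
  rw [absSeries, map_add]
  have h1 : rankCoeff m k (oneSubInv (rankVarInv * X ^ (0 + 1))) =
      if k = 0 ∧ m = 0 then 1 else 0 := by
    change AddMonoidAlgebra.coeff (PowerSeries.coeff k _) (m : ℤ) = _
    rw [coeff_oneSubInv, T_apply]
    congr 1
    apply propext
    omega
  have h2 : rankCoeff m k (rankVar * X ^ (0 + 1) * oneSubInv (rankVar * X ^ (0 + 1))) =
      if k ≠ 0 ∧ k = m then 1 else 0 := by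
    have e : rankVar * X ^ (0 + 1) * oneSubInv (rankVar * X ^ (0 + 1)) =
        oneSubInv (rankVar * X ^ (0 + 1)) - 1 :=
      eq_sub_of_add_eq' (oneSubInv_eq (X_dvd_mul_X_pow _ 0)).symm
    rw [e, map_sub, rankCoeff_one]
    change AddMonoidAlgebra.coeff (PowerSeries.coeff k _) (m : ℤ) - _ = _
    rw [coeff_oneSubInv, T_apply]
    split_ifs <;> omega
  rw [h1, h2]
  split_ifs <;> omega

/-- Expanded, `pairInv 0` is `∑ z^(a-b) q^(a+b)`, and `(a, b)` is determined by the exponents. The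
induction peels off the terms with `a = 0` or `b = 0`, which form `absSeries`. -/
theorem rankCoeff_pairInv (m k : ℕ) : rankCoeff m k (pairInv 0) ≤ 1 ∧
    (0 < rankCoeff m k (pairInv 0) → ∃ s, k = m + 2 * s) := by
  have e : pairInv 0 = absSeries + X * (X * pairInv 0) := by rw [absSeries_eq]; ring
  induction k using Nat.strong_induction_on with
  | _ k ih =>
    rw [e, map_add, rankCoeff_absSeries]
    match k, ih with
    | 0, _ =>
      rw [rankCoeff_zero_X_mul, add_zero]
      split_ifs with h
      · exact ⟨le_rfl, fun _ => ⟨0, h⟩⟩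
      · simp
    | 1, _ =>
      rw [rankCoeff_X_mul, rankCoeff_zero_X_mul, add_zero]
      split_ifs with h
      · exact ⟨le_rfl, fun _ => ⟨0, h⟩⟩
      · simp
    | k + 2, ih =>
      rw [rankCoeff_X_mul, rankCoeff_X_mul]
      obtain ⟨h1, h2⟩ := ih k (by omega)
      split_ifs with h
      · have : ¬ 0 < rankCoeff m k (pairInv 0) := fun h0 => by
          obtain ⟨s, hs⟩ := h2 h0
          omega
        exact ⟨by omega, fun _ => ⟨0, h⟩⟩
      · refine ⟨by omega, fun h0 => ?_⟩
        obtain ⟨s, hs⟩ := h2 (by omega)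
        exact ⟨s + 1, by omega⟩

theorem overN_eq_rankCoeff (m : ℤ) (n : ℕ) : (overN m n : ℤ) =
    rankCoeff m n 1 + rankCoeff m n (X * (2 * dTail rankVar rankVarInv 0)) := by
  rw [overN_eq_coeff, ← map_add, ← mul_assoc]
  rfl

theorem overN_mono (m n : ℕ) (h : n ≠ m + 2) (h' : (m, n) ≠ (0, 4)) :
    overN (m : ℤ) ((n : ℤ) - 1) ≤ overN (m : ℤ) (n : ℤ) := by
  match n, h, h' with
  | 0, _, _ => exact Nat.zero_le _
  -- Here the empty overpartition is counted in degree `0`; the constant term of `dTail`, taken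
  -- twice, outweighs it.
  | 1, _, _ =>
    have h0 := overN_eq_rankCoeff m 0
    have h1 := overN_eq_rankCoeff m 1
    have hd := CoeffNonneg.dTail_sub 0 0 0
    rw [pow_zero, pow_zero, mul_one] at hd
    have hd := hd.le m 0
    have hp := CoeffNonneg.one m 0
    rw [rankCoeff_zero_X_mul] at h0
    rw [rankCoeff_X_mul, two_mul, map_add, rankCoeff_one m 1, if_neg (by simp)] at h1
    rw [show ((1 : ℕ) : ℤ) - 1 = ((0 : ℕ) : ℤ) by norm_num]
    omega
  | k + 2, h, h' =>
    have h0 := overN_eq_rankCoeff m (k + 1)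
    have h1 := overN_eq_rankCoeff m (k + 2)
    rw [rankCoeff_X_mul, two_mul, map_add, rankCoeff_one, if_neg (by simp)] at h0 h1
    have key := congrArg (rankCoeff m (k + 1)) one_sub_X_mul_dTail_zero
    rw [sub_mul, sub_mul, one_mul, one_mul, map_sub, map_add, map_sub, rankCoeff_X_mul,
      rankCoeff_X_mul, rankCoeff_X_mul] at key
    have hJ := CoeffNonneg.pairInv 0 m (k + 1)
    have hK := (CoeffNonneg.X.mul (CoeffNonneg.absSeries.mul (CoeffNonneg.dTail 1))) m k
    obtain ⟨hle, hex⟩ := rankCoeff_pairInv m k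
    rw [show ((k + 2 : ℕ) : ℤ) - 1 = ((k + 1 : ℕ) : ℤ) by push_cast; ring]
    -- The only negative contribution to `key` is the coefficient of `pairInv 0` in degree `k`. If
    -- it is positive it equals `1` and `k = m + 2s`, with `s ≠ 0` because `n ≠ m + 2`.
    by_cases hpos : 0 < rankCoeff m k (pairInv 0)
    · obtain ⟨s, hs⟩ := hex hpos
      obtain ⟨s, rfl⟩ : ∃ j, s = j + 1 := ⟨s - 1, by omega⟩
      obtain rfl : k = m + 1 + 2 * s + 1 := by omega
      have hge := one_le_rankCoeff_absSeries_mul_dTail m s (by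
        by_contra hc
        push Not at hc
        obtain ⟨rfl, rfl⟩ := hc
        exact h' rfl)
      rw [rankCoeff_X_mul] at key
      omega
    · omega

theorem theorem1p4 :
    (∀ m n : ℕ, n ≠ m + 2 → (m, n) ≠ (0, 4) →
      overN (m : ℤ) (n : ℤ) ≥ overN (m : ℤ) ((n : ℤ) - 1)) ∧
    (∀ m n : ℕ, overN2 (m : ℤ) (n : ℤ) ≥ overN2 (m : ℤ) ((n : ℤ) - 1)) ∧
    (∀ m n : ℤ, overN (-m) n = overN m n) ∧
    (∀ m n : ℤ, overN2 (-m) n = overN2 m n) :=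
  ⟨overN_mono, fun m n => overN2_mono m n, overN_neg, overN2_neg⟩
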